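/- Let $k$ be a finite field of characteristic $p$, let $\ell\neq p$ be a prime, let $X$ be a variety over $k$ (a separated connected $k$-scheme of finite type) with a geometric point $\bar x$, let $\overline X$ be a compactification of $X$ (a proper $k$-scheme containing $X$ as a dense open subscheme), and let $D$ be an effective Cartier divisor on $\overline X$ whose support lies in $Z=\overline X\setminus X$. For a closed integral subscheme of $X$ of dimension $1$, let $\phi:C\to X$ be its normalization, let $\overline C$ be the smooth compactification of $C$, let $\overline\phi:\overline C\to\overline X$ be the extension of $\phi$, and for $z\in\overline C\setminus C$ let $k(C)_z$ be the completion of the function field $k(C)$ at $z$. For a complete discrete valuation field $K$ with perfect residue field, let $(G_K^\lambda)_{\lambda}$ be the ramification filtration of $G_K=\mathrm{Gal}(K^{\mathrm{sep}}/K)$ in the upper numbering, and let $G_K^{\lambda+}$ be the closure of $\bigcup_{\lambda'>\lambda}G_K^{\lambda'}$. An étale covering (finite étale morphism) $X'\to X$ has ramification bounded by $D$ if, for all such $\phi:C\to X$ and all $z\in\overline C\setminus C$, every local extension $L=k(C')_{z'}$ of $K=k(C)_z$ (with $C'$ an irreducible component of $C\times_XX'$ and $z'$ a point above $z$ of its smooth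 compactification) satisfies $G_K^{m+}\subset G_L$, where $m$ is the multiplicity of $\overline\phi^{*}D$ at $z$. The group $\pi_1(X,D,\bar x)$ is the fundamental group of the Galois category of these coverings; it is a quotient of $\pi_1(X,\bar x)$. The Swan conductor of a $\overline{\mathbb Q}_\ell$-representation $V$ of $G_K$ is $\mathrm{Sw}(V)=\sum_{\lambda>0}\lambda\dim\bigl(V^{G_K^{\lambda+}}/V^{G_K^{\lambda}}\bigr)$. For a smooth $\overline{\mathbb Q}_\ell$-sheaf $\mathcal F$ on $X$ and an effective Cartier divisor $D'$ on $\overline X$ with support in $Z$, write $\mathrm{Sw}(\mathcal F)\le D'$ if, for every $\phi:C\to X$ as above and every $z\in\overline C\setminus C$, the Swan conductor of the representation of $G_{k(C)_z}$ given by $\mathcal F|_{\mathrm{Spec}\,k(C)_z}$ is at most the multiplicity of $\overline\phi^{*}D'$ at $z$. **Lemma.** Let $\mathcal F$ be a smooth $\overline{\mathbb Q}_\ell$-sheaf on $X$ of rank $r$. If the corresponding representation $\rho:\pi_1(X,\bar x)\to\mathrm{Aut}(\mathcal F_{\bar x})$ factors through $\pi_1(X,D,\bar x)$, then $\mathrm{Sw}(\mathcal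 F)\le rD$. -/

import Mathlib

universe u

open CategoryTheory Limits Opposite AlgebraicGeometry TensorProduct
open scoped ENNReal

noncomputable section

namespace SwanBound

/-! ### Ramification filtrations of a local field

`A` is the valuation ring of a complete discrete valuation field `K`. -/

section Ramification

variable {K : Type u} [Field K] (A : ValuationSubring K)

/-- The ramification subgroup `Gal(L/K)_μ` in the lower numbering: the automorphisms that act
trivially on `O_L / 𝔪_L ^ n`, where `n` is the least natural number `≥ μ + 1`. Here `O_L` is the
integral closure of `A` in `L`; it is a local ring, so its Jacobson radical is `𝔪_L`. -/
def lowerGroup (L : Type u) [Field L] [Algebra K L] (μ : ℝ) : Subgroup Gal(L/K) :=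
  ((Ideal.jacobson (⊥ : Ideal (integralClosure A L))) ^ ⌈μ + 1⌉₊).toAddSubgroup.inertia Gal(L/K)

/-- The Herbrand function `φ_{L/K}(μ) = ∫_0^μ dx / (Gal(L/K)_0 : Gal(L/K)_x)`. -/
def herbrand (L : Type u) [Field L] [Algebra K L] (μ : ℝ) : ℝ :=
  ∫ x in (0 : ℝ)..μ, (((lowerGroup A L x).relIndex (lowerGroup A L 0) : ℕ) : ℝ)⁻¹

/-- The ramification subgroup in the upper numbering: `Gal(L/K)^{φ(μ)} = Gal(L/K)_μ` for
`μ ≥ -1`. (As `φ` is a bijection of `[-1, ∞)`, the supremum is over exactly one `μ`.) -/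
def upperGroup (L : Type u) [Field L] [Algebra K L] (lam : ℝ) : Subgroup Gal(L/K) :=
  ⨆ (μ : ℝ) (_ : -1 ≤ μ) (_ : herbrand A L μ = lam), lowerGroup A L μ

/-- `G_K^λ`, the inverse limit of the `Gal(L/K)^λ` over the finite Galois extensions `L/K` inside
the separable closure. -/
def absUpperGroup (lam : ℝ) : Subgroup Gal(SeparableClosure K/K) :=
  ⨅ (L : IntermediateField K (SeparableClosure K)) (_ : FiniteDimensional K L) (_ : IsGalois K L),
    (upperGroup A L lam).comap (AlgEquiv.restrictNormalHom L)

/-- `G_K^{λ+}`, the closure of the union of the (nested) subgroups `G_K^{λ'}`, `λ' > λ`. -/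
def absUpperGroupPlus (lam : ℝ) : Subgroup Gal(SeparableClosure K/K) :=
  (⨆ (lam' : ℝ) (_ : lam < lam'), absUpperGroup A lam').topologicalClosure

/-- The ramification of the separable extension `i : K → L` is bounded by `λ`:
`G_K^{λ+}` is contained in `Gal(K^sep/L)`, for every embedding `e` of `L` over `K`. -/
def RamificationBounded {L : Type u} [Field L] (i : K →+* L) (lam : ℝ) : Prop :=
  ∀ e : L →+* SeparableClosure K, e.comp i = algebraMap K (SeparableClosure K) →
    ∀ σ ∈ absUpperGroupPlus A lam, ∀ x : L, σ (e x) = e x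

variable {F : Type} [Field F] {V : Type u} [AddCommGroup V] [Module F V]

/-- The subspace `V^H` of vectors fixed by a subgroup `H`. -/
def fixedBy {G : Type u} [Group G] (ρ : Representation F G V) (H : Subgroup G) : Submodule F V :=
  Representation.invariants (ρ.comp H.subtype)

/-- The Swan conductor `∑_{λ > 0} λ dim (V^{G_K^{λ+}} / V^{G_K^λ})`. -/
def swan (ρ : Representation F Gal(SeparableClosure K/K) V) : ℝ≥0∞ :=
  ∑' lam : {t : ℝ // 0 < t}, ENNReal.ofReal lam.1 *
    (Module.finrank F (fixedBy ρ (absUpperGroupPlus A lam.1) ⧸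
      (fixedBy ρ (absUpperGroup A lam.1)).submoduleOf
        (fixedBy ρ (absUpperGroupPlus A lam.1))) : ℝ≥0∞)

end Ramification

/-! ### Étale coverings, fibre functors and fundamental groups -/

/-- A morphism is an étale covering if it is finite étale. -/
def isCovering (X : Scheme.{u}) : ObjectProperty (Over X) :=
  fun Y => IsFinite Y.hom ∧ Etale Y.hom

/-- The category `Cov(X)` of étale coverings of `X`. -/
abbrev Cov (X : Scheme.{u}) : Type (u + 1) := (isCovering X).FullSubcategory

/-- The fibre functor `Y ↦ Hom_X(x, Y)` of a geometric point `x`, on the full subcategory of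
`X`-schemes cut out by `P`. -/
def fibre {X : Scheme.{u}} (P : ObjectProperty (Over X)) {Ω : Type u} [Field Ω]
    (x : Spec (.of Ω) ⟶ X) : P.FullSubcategory ⥤ Type u :=
  P.ι ⋙ coyoneda.obj (op (Over.mk x))

/-- The fundamental group of the Galois category of coverings cut out by `P`, at the geometric
point `x`: the automorphism group of the fibre functor. -/
abbrev fundamentalGroup {X : Scheme.{u}} (P : ObjectProperty (Over X)) {Ω : Type u} [Field Ω]
    (x : Spec (.of Ω) ⟶ X) : Type (u + 1) := Aut (fibre P x)

/-- The homomorphism of fundamental groups induced by the inclusion of a full subcategory. -/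
def restrictHom {X : Scheme.{u}} {P Q : ObjectProperty (Over X)} (h : P ≤ Q) {Ω : Type u}
    [Field Ω] (x : Spec (.of Ω) ⟶ X) : fundamentalGroup Q x →* fundamentalGroup P x where
  toFun σ := Functor.isoWhiskerLeft (ObjectProperty.ιOfLE h) σ
  map_one' := rfl
  map_mul' _ _ := rfl

/-! ### Varieties, compactifications and effective Cartier divisors -/

/-- A variety over `k`: a separated connected scheme of finite type. -/
class IsVariety {k : Type u} [Field k] {X : Scheme.{u}} (s : X ⟶ Spec (.of k)) : Prop where
  separated : IsSeparated s
  locallyOfFiniteType : LocallyOfFiniteType s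
  quasiCompact : QuasiCompact s
  connected : ConnectedSpace X

/-- A compactification of a scheme `X` over `k`. -/
structure Compactification {k : Type u} [Field k] {X : Scheme.{u}} (s : X ⟶ Spec (.of k)) where
  space : Scheme.{u}
  str : space ⟶ Spec (.of k)
  ι : X ⟶ space
  proper : IsProper str
  isOpenImmersion : IsOpenImmersion ι
  dominant : IsDominant ι
  fac : ι ≫ str = s

/-- An effective Cartier divisor: an ideal sheaf that is locally generated by a
non-zero-divisor. -/
def IsCartier {X : Scheme.{u}} (I : X.IdealSheafData) : Prop :=
  ∀ x : X, ∃ U : X.affineOpens, x ∈ U.1 ∧ ∃ f ∈ nonZeroDivisors Γ(X, U), I.ideal U = Ideal.span {f}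

/-- The set `Div_Z(X̄)` of effective Cartier divisors on `X̄` with support in `Z = X̄ ∖ X`. -/
structure BoundaryDivisor {k : Type u} [Field k] {X : Scheme.{u}} {s : X ⟶ Spec (.of k)}
    (Xb : Compactification s) where
  ideal : Xb.space.IdealSheafData
  cartier : IsCartier ideal
  support : Disjoint (ideal.support : Set Xb.space) (Set.range Xb.ι)

/-- The multiple `r D` of an effective Cartier divisor: its local equations are the `r`-th powers
of those of `D`. -/
def BoundaryDivisor.smul {k : Type u} [Field k] {X : Scheme.{u}} {s : X ⟶ Spec (.of k)}
    {Xb : Compactification s} (r : ℕ) (D : BoundaryDivisor Xb) : BoundaryDivisor Xb where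
  ideal := D.ideal ^ r
  cartier x := by
    obtain ⟨U, hx, f, hf, h⟩ := D.cartier x
    refine ⟨U, hx, f ^ r, pow_mem hf r, ?_⟩
    rw [Scheme.IdealSheafData.ideal_pow, Pi.pow_apply, h, Ideal.span_singleton_pow]
  support := by
    rcases Nat.eq_zero_or_pos r with rfl | hr
    · simp
    · rw [Scheme.IdealSheafData.support_pow _ _ hr.ne']
      exact D.support

/-- The stalk at `x` of an ideal sheaf, as an ideal of the local ring at `x`. -/
def stalkIdeal {X : Scheme.{u}} (I : X.IdealSheafData) (x : X) : Ideal (X.presheaf.stalk x) :=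
  ⨆ (U : X.affineOpens) (h : x ∈ U.1), (I.ideal U).map (X.presheaf.germ U.1 x h).hom

/-- The order of a nonzero ideal `J` of a discrete valuation ring: `J = 𝔪 ^ n`. -/
def idealOrder {R : Type u} [CommRing R] [IsLocalRing R] (J : Ideal R) : ℕ :=
  sSup {n : ℕ | J ≤ IsLocalRing.maximalIdeal R ^ n}

/-! ### Curves on a variety, and their points at infinity -/

attribute [instance] Compactification.proper Compactification.isOpenImmersion
  Compactification.dominant IsVariety.separated

/-- A closed integral subscheme `W` of dimension one. -/
structure CurveIn (X : Scheme.{u}) where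
  W : Scheme.{u}
  incl : W ⟶ X
  isClosedImmersion : IsClosedImmersion incl
  integral : IsIntegral W
  dim : topologicalKrullDim W = 1

attribute [instance] CurveIn.isClosedImmersion CurveIn.integral

namespace CurveIn

variable {X : Scheme.{u}} (T : CurveIn X)

/-- The inclusion `Spec k(W) → W` of the generic point. -/
def generic : Spec T.W.functionField ⟶ T.W :=
  T.W.fromSpecStalk (genericPoint T.W)

theorem quasiSeparatedSpace {k : Type u} [Field k] (s : X ⟶ Spec (.of k)) [IsVariety s] :
    QuasiSeparatedSpace T.W :=
  quasiSeparatedSpace_of_quasiSeparated (T.incl ≫ s)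

theorem quasiCompact_generic {k : Type u} [Field k] (s : X ⟶ Spec (.of k)) [IsVariety s] :
    QuasiCompact T.generic :=
  have := T.quasiSeparatedSpace s
  quasiCompact_of_compactSpace T.generic

theorem quasiSeparated_generic : QuasiSeparated T.generic := by
  unfold generic
  infer_instance

/-- The normalization `C` of `W`, that is, the normalization of `W` in its function field. -/
def C {k : Type u} [Field k] (s : X ⟶ Spec (.of k)) [IsVariety s] : Scheme.{u} :=
  have := T.quasiCompact_generic s
  have := T.quasiSeparated_generic
  T.generic.normalization

/-- The canonical morphism `φ : C → W → X`. -/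
def φ {k : Type u} [Field k] (s : X ⟶ Spec (.of k)) [IsVariety s] : T.C s ⟶ X :=
  have := T.quasiCompact_generic s
  have := T.quasiSeparated_generic
  T.generic.fromNormalization ≫ T.incl

end CurveIn

/-- The smooth compactification of a curve: an integral, smooth compactification. Its local rings
away from the generic point are discrete valuation rings. -/
structure SmoothCompactification {k : Type u} [Field k] {C : Scheme.{u}} (s : C ⟶ Spec (.of k))
    extends Compactification s where
  integral : IsIntegral space
  smooth : Smooth str
  regular : ∀ z : space, z ≠ genericPoint space → IsDiscreteValuationRing (space.presheaf.stalk z)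

attribute [instance] SmoothCompactification.integral

/-- A curve `φ : C → X` in `Cu(X)` with its smooth compactification `C̄`, the extension
`φ̄ : C̄ → X̄` of `φ`, and a point `z` of `C̄ ∖ C`. -/
structure PointAtInfinity {k : Type u} [Field k] {X : Scheme.{u}} {s : X ⟶ Spec (.of k)}
    [IsVariety s] (Xb : Compactification s) where
  curve : CurveIn X
  Cb : SmoothCompactification (curve.φ s ≫ s)
  φb : Cb.space ⟶ Xb.space
  φb_str : φb ≫ Xb.str = Cb.str
  ι_φb : Cb.ι ≫ φb = curve.φ s ≫ Xb.ι
  z : Cb.space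
  hz : z ∉ Set.range Cb.ι

namespace PointAtInfinity

variable {k : Type u} [Field k] {X : Scheme.{u}} {s : X ⟶ Spec (.of k)} [IsVariety s]
  {Xb : Compactification s} (P : PointAtInfinity Xb)

theorem mem_range_of_specializes {y : P.Cb.space} (hy : y ⤳ genericPoint P.Cb.space) :
    y ∈ Set.range P.Cb.ι := by
  have ho : IsOpen (Set.range P.Cb.ι) := P.Cb.ι.isOpenEmbedding.isOpen_range
  have hd : DenseRange P.Cb.ι := P.Cb.ι.denseRange
  have : Nonempty P.Cb.space := ⟨P.z⟩
  obtain ⟨w⟩ := hd.nonempty_iff.2 this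
  refine hy.mem_open ho ?_
  exact ((genericPoint_spec P.Cb.space).mem_open_set_iff ho).2 (by simpa using ⟨_, ⟨w, rfl⟩⟩)

theorem ne_genericPoint : P.z ≠ genericPoint P.Cb.space := fun h =>
  P.hz (P.mem_range_of_specializes (h ▸ specializes_rfl))

instance : IsDiscreteValuationRing (P.Cb.space.presheaf.stalk P.z) :=
  P.Cb.regular P.z P.ne_genericPoint

/-- The local field `k(C)_z`: the completion of the function field at `z`. -/
abbrev K : Type u :=
  (IsDiscreteValuationRing.maximalIdeal (P.Cb.space.presheaf.stalk P.z)).adicCompletion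
    P.Cb.space.functionField

/-- The valuation ring of `k(C)_z`. -/
abbrev O : ValuationSubring P.K :=
  (IsDiscreteValuationRing.maximalIdeal (P.Cb.space.presheaf.stalk P.z)).adicCompletionIntegers
    P.Cb.space.functionField

/-- The canonical morphism `Spec k(C)_z → Spec k(C) → C̄`. -/
def specK : Spec (.of P.K) ⟶ P.Cb.space :=
  Spec.map (CommRingCat.ofHom (algebraMap P.Cb.space.functionField P.K)) ≫
    P.Cb.space.fromSpecStalk (genericPoint P.Cb.space)

theorem range_specK : Set.range P.specK ⊆ Set.range P.Cb.ι := by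
  rintro _ ⟨x, rfl⟩
  apply P.mem_range_of_specializes
  have : P.specK x ∈ Set.range (P.Cb.space.fromSpecStalk (genericPoint P.Cb.space)) := by
    simp [specK]
  rwa [Scheme.range_fromSpecStalk] at this

/-- The canonical morphism `Spec k(C)_z → C → X`. -/
def toX : Spec (.of P.K) ⟶ X :=
  IsOpenImmersion.lift P.Cb.ι P.specK P.range_specK ≫ P.curve.φ s

/-- The multiplicity at `z` of the inverse image `φ̄^* D`: the order of the ideal of `𝒪_{C̄,z}`
generated by the pullback of a local equation of `D` at `φ̄(z)`. This ideal is nonzero, because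
`φ̄` maps the generic point of `C̄` into `X`. -/
def mult (D : BoundaryDivisor Xb) : ℕ :=
  idealOrder ((stalkIdeal D.ideal (P.φb P.z)).map (P.φb.stalkMap P.z).hom)

end PointAtInfinity

/-! ### Coverings with bounded ramification -/

/-- The ramification of `Y → X` is bounded by `D`: for every `φ : C → X` in `Cu(X)` and every
point `z` of `C̄ ∖ C`, the local extensions of `k(C)_z` defined by `C ×_X Y → C` have
ramification bounded by the multiplicity of `φ̄^* D` at `z`. These extensions `k(C')_{z'}/k(C)_z`,
where `C'` is an irreducible component of `C ×_X Y` and `z'` lies above `z`, are the residue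
fields of the finite étale `k(C)_z`-scheme `Y ×_X Spec k(C)_z`. -/
def HasBoundedRamification {k : Type u} [Field k] {X : Scheme.{u}} {s : X ⟶ Spec (.of k)}
    [IsVariety s] {Xb : Compactification s} (D : BoundaryDivisor Xb) (Y : Over X) : Prop :=
  ∀ (P : PointAtInfinity Xb) (y : ↥(pullback Y.hom P.toX)),
    RamificationBounded P.O
      (Spec.preimage ((pullback Y.hom P.toX).fromSpecResidueField y ≫ pullback.snd _ _)).hom
      (P.mult D)

/-- The étale coverings of `X` with ramification bounded by `D`. -/
def isBoundedCovering {k : Type u} [Field k] {X : Scheme.{u}} {s : X ⟶ Spec (.of k)}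
    [IsVariety s] {Xb : Compactification s} (D : BoundaryDivisor Xb) : ObjectProperty (Over X) :=
  fun Y => isCovering X Y ∧ HasBoundedRamification D Y

theorem isBoundedCovering_le {k : Type u} [Field k] {X : Scheme.{u}} {s : X ⟶ Spec (.of k)}
    [IsVariety s] {Xb : Compactification s} (D : BoundaryDivisor Xb) :
    isBoundedCovering D ≤ isCovering X :=
  fun _ h => h.1

/-! ### Smooth `ℓ`-adic sheaves -/

/-- The ring of integers `O_E` of a subextension `E` of `ℚ̄_ℓ / ℚ_ℓ`. -/
def IntRing {ℓ : ℕ} [Fact ℓ.Prime] (E : IntermediateField ℚ_[ℓ] (PadicAlgCl ℓ)) : Type :=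
  integralClosure ℤ_[ℓ] E

instance {ℓ : ℕ} [Fact ℓ.Prime] (E : IntermediateField ℚ_[ℓ] (PadicAlgCl ℓ)) :
    CommRing (IntRing E) :=
  inferInstanceAs (CommRing (integralClosure ℤ_[ℓ] E))

instance {ℓ : ℕ} [Fact ℓ.Prime] (E : IntermediateField ℚ_[ℓ] (PadicAlgCl ℓ)) :
    Algebra (IntRing E) (PadicAlgCl ℓ) :=
  inferInstanceAs (Algebra (integralClosure ℤ_[ℓ] E) (PadicAlgCl ℓ))

/-- A smooth `ℚ̄_ℓ`-sheaf on `X`: it is represented by a finite extension `E / ℚ_ℓ` with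
uniformizer `ϖ` and a projective system `(F_n)` of locally constant constructible sheaves of
`O_E`-modules, where `F_n` is killed by `ϖ ^ (n + 1)` and `F_{n+1} / ϖ ^ (n + 1) F_{n+1} ≅ F_n`.
A locally constant constructible sheaf is a sheaf that is represented by an étale covering of `X`;
it is given here together with its inverse images, as a functor on all `X`-schemes. In particular
its stalk at a geometric point `x` is the module of its sections over `x`. -/
structure SmoothSheaf (ℓ : ℕ) [Fact ℓ.Prime] (X : Scheme.{u}) where
  E : IntermediateField ℚ_[ℓ] (PadicAlgCl ℓ)
  finiteDimensional : FiniteDimensional ℚ_[ℓ] E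
  ϖ : IntRing E
  irreducible : Irreducible ϖ
  sheaf : ℕ → (Over X)ᵒᵖ ⥤ ModuleCat.{u} (IntRing E)
  cov : ℕ → Over X
  covering : ∀ n, isCovering X (cov n)
  repr : ∀ n, (sheaf n ⋙ forget _).RepresentableBy (cov n)
  trans : ∀ n, sheaf (n + 1) ⟶ sheaf n
  torsion : ∀ (n : ℕ) (T : (Over X)ᵒᵖ) (a : (sheaf n).obj T), ϖ ^ (n + 1) • a = 0
  trans_surjective : ∀ (n : ℕ) (Ω : Type u) [Field Ω] [IsSepClosed Ω] (x : Spec (.of Ω) ⟶ X),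
    Function.Surjective ((trans n).app (op (Over.mk x)))
  trans_eq_zero_iff : ∀ (n : ℕ) (Ω : Type u) [Field Ω] [IsSepClosed Ω] (x : Spec (.of Ω) ⟶ X)
    (a : (sheaf (n + 1)).obj (op (Over.mk x))),
    (trans n).app (op (Over.mk x)) a = 0 ↔ ∃ b, a = ϖ ^ (n + 1) • b

namespace SmoothSheaf

variable {ℓ : ℕ} [Fact ℓ.Prime] {X : Scheme.{u}} (F : SmoothSheaf ℓ X)

/-- The sections of `F_n` over an `X`-scheme `T`. -/
abbrev sec (n : ℕ) (T : Over X) : Type u := (F.sheaf n).obj (op T)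

/-- The `O_E`-module `lim_n F_n(T)`. -/
def lattice (T : Over X) : Submodule (IntRing F.E) (∀ n, F.sec n T) where
  carrier := {a | ∀ n, (F.trans n).app (op T) (a (n + 1)) = a n}
  add_mem' ha hb n := by simp [ha n, hb n]
  zero_mem' n := by simp
  smul_mem' c a ha n := by simp [ha n]

/-- The stalk `F_x = ℚ̄_ℓ ⊗ lim_n F_{n,x}` (for `T` a geometric point `x`). -/
abbrev stalk (T : Over X) : Type u := PadicAlgCl ℓ ⊗[IntRing F.E] F.lattice T

/-- Compatible endomorphisms of the `F_n(T)` induce an endomorphism of `lim_n F_n(T)`. -/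
def latticeEnd (T : Over X) (f : ∀ n, Module.End (IntRing F.E) (F.sec n T))
    (hf : ∀ n a, (F.trans n).app (op T) (f (n + 1) a) = f n ((F.trans n).app (op T) a)) :
    Module.End (IntRing F.E) (F.lattice T) :=
  (LinearMap.pi fun n => f n ∘ₗ LinearMap.proj n).restrict fun a ha n => by
    change (F.trans n).app (op T) (f (n + 1) (a (n + 1))) = f n (a n)
    rw [hf, ha n]

/-- The endomorphism of the stalk induced by compatible endomorphisms of the `F_n(T)`. -/
def stalkEnd (T : Over X) (f : ∀ n, Module.End (IntRing F.E) (F.sec n T))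
    (hf : ∀ n a, (F.trans n).app (op T) (f (n + 1) a) = f n ((F.trans n).app (op T) a)) :
    Module.End (PadicAlgCl ℓ) (F.stalk T) :=
  (F.latticeEnd T f hf).baseChange (PadicAlgCl ℓ)

theorem stalkEnd_one (T : Over X) (f : ∀ n, Module.End (IntRing F.E) (F.sec n T))
    (hf : ∀ n a, (F.trans n).app (op T) (f (n + 1) a) = f n ((F.trans n).app (op T) a))
    (h : ∀ n a, f n a = a) : F.stalkEnd T f hf = 1 := by
  have : F.latticeEnd T f hf = LinearMap.id :=
    LinearMap.ext fun a => Subtype.ext (funext fun n => h n (a.1 n))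
  rw [stalkEnd, this, LinearMap.baseChange_id]
  rfl

theorem stalkEnd_mul (T : Over X) (f g e : ∀ n, Module.End (IntRing F.E) (F.sec n T))
    (hf : ∀ n a, (F.trans n).app (op T) (f (n + 1) a) = f n ((F.trans n).app (op T) a))
    (hg : ∀ n a, (F.trans n).app (op T) (g (n + 1) a) = g n ((F.trans n).app (op T) a))
    (he : ∀ n a, (F.trans n).app (op T) (e (n + 1) a) = e n ((F.trans n).app (op T) a))
    (h : ∀ n a, f n a = g n (e n a)) :
    F.stalkEnd T f hf = F.stalkEnd T g hg * F.stalkEnd T e he := by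
  have : F.latticeEnd T f hf = F.latticeEnd T g hg ∘ₗ F.latticeEnd T e he :=
    LinearMap.ext fun a => Subtype.ext (funext fun n => h n (a.1 n))
  rw [stalkEnd, this, LinearMap.baseChange_comp]
  rfl

/-! #### The Galois action on the stalk over a field -/

section Galois

variable {K : Type u} [Field K] (a : Spec (.of K) ⟶ X)

/-- The geometric point `Spec K^sep → Spec K → X`. -/
def sepPoint : Over X :=
  Over.mk (Spec.map (CommRingCat.ofHom (algebraMap K (SeparableClosure K))) ≫ a)

/-- The automorphism of the geometric point given by an element of the Galois group. -/
def sepHom (σ : Gal(SeparableClosure K/K)) : sepPoint a ⟶ sepPoint a :=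
  Over.homMk (Spec.map (CommRingCat.ofHom (σ : SeparableClosure K →+* SeparableClosure K))) (by
    simp only [sepPoint, Over.mk_hom, ← Category.assoc, ← Spec.map_comp, ← CommRingCat.ofHom_comp]
    congr 3
    ext x
    exact congrArg _ (σ.commutes x))

theorem sepHom_one : sepHom a 1 = 𝟙 _ := by
  ext1
  exact Spec.map_id _

theorem sepHom_mul (σ τ : Gal(SeparableClosure K/K)) :
    sepHom a (σ * τ) = sepHom a σ ≫ sepHom a τ := by
  ext1
  exact Spec.map_comp (CommRingCat.ofHom (τ : SeparableClosure K →+* SeparableClosure K))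
    (CommRingCat.ofHom (σ : SeparableClosure K →+* SeparableClosure K))

/-- The representation of `G_K` on the stalk of `F` at `Spec K^sep → Spec K → X`, by functoriality;
it corresponds to the inverse image of `F` on `Spec K`. -/
def galoisRep :
    Representation (PadicAlgCl ℓ) Gal(SeparableClosure K/K) (F.stalk (sepPoint a)) where
  toFun σ := F.stalkEnd (sepPoint a) (fun n => ((F.sheaf n).map (sepHom a σ).op).hom)
    fun n b => (ConcreteCategory.congr_hom ((F.trans n).naturality (sepHom a σ).op) b)
  map_one' := F.stalkEnd_one _ _ _ fun n b => by
    simp [sepHom_one]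
  map_mul' σ τ := F.stalkEnd_mul _ _ _ _ _ _ _ fun n b => by
    simp [sepHom_mul]

end Galois

/-! #### The monodromy representation -/

section Monodromy

variable {Ω : Type u} [Field Ω] (x : Spec (.of Ω) ⟶ X)

/-- The étale covering representing `F_n`, as an object of `Cov(X)`. -/
def covObj (n : ℕ) : Cov X := ⟨F.cov n, F.covering n⟩

/-- The action of `π₁(X, x)` on the fibre at `x` of an étale covering. -/
def move (σ : fundamentalGroup (isCovering X) x) (Y : Cov X) (y : Over.mk x ⟶ Y.obj) :
    Over.mk x ⟶ Y.obj :=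
  σ.hom.app Y y

theorem move_comp (σ : fundamentalGroup (isCovering X) x) {Y Y' : Cov X} (f : Y ⟶ Y')
    (y : Over.mk x ⟶ Y.obj) : move x σ Y' (y ≫ f.hom) = move x σ Y y ≫ f.hom :=
  ConcreteCategory.congr_hom (σ.hom.naturality f) y

/-- The action of `π₁(X, x)` on `F_{n,x}`, through the bijection of `F_{n,x}` with the fibre at `x`
of the étale covering that represents `F_n`. -/
def piAct (σ : fundamentalGroup (isCovering X) x) (n : ℕ) (a : F.sec n (Over.mk x)) :
    F.sec n (Over.mk x) :=
  (F.repr n).homEquiv (move x σ (F.covObj n) ((F.repr n).homEquiv.symm a))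

theorem piAct_of_hom (σ : fundamentalGroup (isCovering X) x) {m : ℕ} {Y : Cov X}
    (f : Y.obj ⟶ F.cov m) (y : Over.mk x ⟶ Y.obj) :
    F.piAct x σ m ((F.repr m).homEquiv (y ≫ f)) =
      (F.repr m).homEquiv ((move x σ Y y) ≫ f) := by
  unfold piAct
  rw [Equiv.symm_apply_apply]
  exact congrArg _ (move_comp x σ (Y' := F.covObj m) (ObjectProperty.homMk f) y)

theorem homEquiv_comp {Y T : Over X} (n : ℕ) (y : T ⟶ Y) (f : Y ⟶ F.cov n) :
    (F.repr n).homEquiv (y ≫ f) = (F.sheaf n).map y.op ((F.repr n).homEquiv f) :=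
  (F.repr n).homEquiv_comp y f

theorem piAct_map (σ : fundamentalGroup (isCovering X) x) {m : ℕ} {Y : Cov X}
    (b : F.sec m Y.obj) (y : Over.mk x ⟶ Y.obj) :
    F.piAct x σ m ((F.sheaf m).map y.op b) =
      (F.sheaf m).map (move x σ Y y).op b := by
  obtain ⟨f, rfl⟩ := (F.repr m).homEquiv.surjective b
  have := F.piAct_of_hom x σ f y
  rw [homEquiv_comp, homEquiv_comp] at this
  exact this

/-- Every element of `F_{n,x}` comes from the tautological section over the covering. -/
theorem exists_map (n : ℕ) (a : F.sec n (Over.mk x)) :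
    ∃ y : Over.mk x ⟶ F.cov n, (F.sheaf n).map y.op ((F.repr n).homEquiv (𝟙 _)) = a :=
  ⟨(F.repr n).homEquiv.symm a, by rw [← homEquiv_comp]; simp⟩

theorem piAct_smul (σ : fundamentalGroup (isCovering X) x) (n : ℕ) (c : IntRing F.E)
    (a : F.sec n (Over.mk x)) : F.piAct x σ n (c • a) = c • F.piAct x σ n a := by
  obtain ⟨y, rfl⟩ := F.exists_map x n a
  have h1 := F.piAct_map x σ (Y := F.covObj n) ((F.repr n).homEquiv (𝟙 _)) y
  have h2 := F.piAct_map x σ (Y := F.covObj n) (c • (F.repr n).homEquiv (𝟙 _)) y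
  refine (congrArg _ (map_smul ((F.sheaf n).map y.op).hom c _).symm).trans (h2.trans ?_)
  refine (map_smul ((F.sheaf n).map (move x σ (F.covObj n) y).op).hom c _).trans ?_
  exact congrArg _ h1.symm

/-- The fibre square of an étale covering. -/
def square (n : ℕ) : Cov X :=
  ⟨Over.mk (pullback.fst (F.cov n).hom (F.cov n).hom ≫ (F.cov n).hom), by
    obtain ⟨_, _⟩ := F.covering n
    exact ⟨inferInstanceAs (IsFinite (_ ≫ _)), inferInstanceAs (Etale (_ ≫ _))⟩⟩

theorem piAct_add (σ : fundamentalGroup (isCovering X) x) (n : ℕ) (a b : F.sec n (Over.mk x)) :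
    F.piAct x σ n (a + b) = F.piAct x σ n a + F.piAct x σ n b := by
  obtain ⟨y, rfl⟩ := F.exists_map x n a
  obtain ⟨z, rfl⟩ := F.exists_map x n b
  let p : (F.square n).obj ⟶ F.cov n := Over.homMk (pullback.fst _ _) rfl
  let q : (F.square n).obj ⟶ F.cov n := Over.homMk (pullback.snd _ _) pullback.condition.symm
  let w : Over.mk x ⟶ (F.square n).obj :=
    Over.homMk (pullback.lift y.left z.left ((Over.w y).trans (Over.w z).symm)) (by
      simp only [square, Over.mk_hom, pullback.lift_fst_assoc]
      exact Over.w y)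
  have hp : w ≫ p = y := by ext1; exact pullback.lift_fst _ _ _
  have hq : w ≫ q = z := by ext1; exact pullback.lift_snd _ _ _
  have key (r : (F.square n).obj ⟶ F.cov n) :
      (F.sheaf n).map w.op ((F.sheaf n).map r.op ((F.repr n).homEquiv (𝟙 _))) =
        (F.sheaf n).map (w ≫ r).op ((F.repr n).homEquiv (𝟙 _)) := by
    simp
  rw [← hp, ← hq, ← key, ← key, ← map_add, piAct_map, piAct_map, piAct_map, map_add]

/-- The action of `π₁(X, x)` on `F_{n,x}` as a linear map. -/
def piLin (σ : fundamentalGroup (isCovering X) x) (n : ℕ) :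
    Module.End (IntRing F.E) (F.sec n (Over.mk x)) where
  toFun := F.piAct x σ n
  map_add' := F.piAct_add x σ n
  map_smul' := F.piAct_smul x σ n

theorem trans_piAct (σ : fundamentalGroup (isCovering X) x) (n : ℕ)
    (a : F.sec (n + 1) (Over.mk x)) :
    (F.trans n).app (op (Over.mk x)) (F.piAct x σ (n + 1) a) =
      F.piAct x σ n ((F.trans n).app (op (Over.mk x)) a) := by
  obtain ⟨y, rfl⟩ := F.exists_map x (n + 1) a
  have nat {T : Over X} (t : T ⟶ F.cov (n + 1)) :
      (F.trans n).app (op T) ((F.sheaf (n + 1)).map t.op ((F.repr (n + 1)).homEquiv (𝟙 _))) =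
        (F.sheaf n).map t.op ((F.trans n).app _ ((F.repr (n + 1)).homEquiv (𝟙 _))) :=
    ConcreteCategory.congr_hom ((F.trans n).naturality t.op) _
  rw [nat]
  have h1 := F.piAct_map x σ (Y := F.covObj (n + 1)) ((F.repr (n + 1)).homEquiv (𝟙 _)) y
  have h2 := F.piAct_map x σ (Y := F.covObj (n + 1))
    ((F.trans n).app _ ((F.repr (n + 1)).homEquiv (𝟙 _))) y
  refine Eq.trans ?_ h2.symm
  refine (congrArg _ h1).trans ?_
  exact nat _

/-- The monodromy representation of `π₁(X, x)` on the stalk of `F` at the geometric point `x`. -/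
def monodromy :
    Representation (PadicAlgCl ℓ) (fundamentalGroup (isCovering X) x) (F.stalk (Over.mk x)) where
  toFun σ := F.stalkEnd _ (F.piLin x σ) (F.trans_piAct x σ)
  map_one' := F.stalkEnd_one _ _ _ fun n a => by
    change (F.repr n).homEquiv ((F.repr n).homEquiv.symm a) = a
    simp
  map_mul' σ τ := F.stalkEnd_mul _ _ _ _ _ _ _ fun n a => by
    change (F.repr n).homEquiv _ = (F.repr n).homEquiv _
    congr 1
    exact congrArg (move x σ (F.covObj n)) ((F.repr n).homEquiv.symm_apply_apply _).symm

end Monodromy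

/-! #### Rank, factorization of the monodromy, and the Swan conductor -/

/-- `F` has rank `r`: its stalk at the geometric point `x` has dimension `r`. -/
def HasRank {Ω : Type u} [Field Ω] (x : Spec (.of Ω) ⟶ X) (r : ℕ) : Prop :=
  Module.rank (PadicAlgCl ℓ) (F.stalk (Over.mk x)) = r

variable {k : Type u} [Field k] {s : X ⟶ Spec (.of k)} [IsVariety s] {Xb : Compactification s}

/-- The monodromy representation of `F` at `x` factors through `π₁(X, x) → π₁(X, D, x)`. -/
def FactorsThrough {Ω : Type u} [Field Ω] (x : Spec (.of Ω) ⟶ X) (D : BoundaryDivisor Xb) : Prop :=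
  ∃ ρ : Representation (PadicAlgCl ℓ) (fundamentalGroup (isBoundedCovering D) x)
      (F.stalk (Over.mk x)),
    F.monodromy x = ρ.comp (restrictHom (isBoundedCovering_le D) x)

/-- The Swan conductor of `φ^* F` at the point at infinity `z` of `C`: the Swan conductor of the
Galois representation defined by the inverse image of `F` on `Spec k(C)_z`. -/
def swanAt (P : PointAtInfinity Xb) : ℝ≥0∞ :=
  swan P.O (F.galoisRep P.toX)

/-- `Sw(F) ≤ D`: for every `φ : C → X` in `Cu(X)`, the inequality `Sw(φ^* F) ≤ φ̄^* D` of divisors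
on `C̄` with support in `C̄ ∖ C`. -/
def SwanLE (D : BoundaryDivisor Xb) : Prop :=
  ∀ P : PointAtInfinity Xb, F.swanAt P ≤ (P.mult D : ℝ≥0∞)

end SmoothSheaf

end SwanBound

end

/-!
For geometric points `x`, `x'` of a connected scheme, the fibre functors on finite étale coverings
are isomorphic. The fibre functor at `x` is a cofiltered limit of representable functors, indexed by
its category of elements, so a natural transformation to the fibre functor at `x'` is a compatible
family of points in nonempty finite fibres at `x'`; such a family exists by compactness. A natural
transformation of fibre functors preserves open and closed subschemes, among them the equalizers
that detect whether two points of a fibre agree, so it is injective on fibres. Having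
transformations in both directions between finite fibres, one obtains an isomorphism.

Along such an isomorphism, the representation of `G_K`, `K = k(C)_z`, on the stalk of `F` is the
monodromy representation composed with `G_K → π₁(X, x)`. The image of `G_K^{m+}` in `π₁(X, D, x)`
is trivial, `m` being the multiplicity of `D` at `z`, so `G_K^{m+}` acts trivially on the stalk and
only breaks `λ ≤ m` contribute to the Swan conductor. The graded pieces of the break filtration have
total dimension at most `r`, hence the bound `r m`.
-/

noncomputable section

namespace SwanBound

section Filtration

variable {ι F V : Type*} [LinearOrder ι] [DivisionRing F] [AddCommGroup V] [Module F V]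
  [FiniteDimensional F V] {S T : ι → Submodule F V}

theorem sum_finrank_quotient_le_finrank (hT : Monotone T) (hTS : ∀ ⦃i j⦄, i < j → T i ≤ S j)
    (s : Finset ι) {W : Submodule F V} (hW : ∀ i ∈ s, T i ≤ W) :
    ∑ i ∈ s, Module.finrank F (T i ⧸ (S i).submoduleOf (T i)) ≤ Module.finrank F W := by
  induction s using Finset.induction_on_max generalizing W with
  | empty => simp
  | insert j s hs ih =>
    have sum_le := ih (W := T j ⊓ S j) fun i hi => le_inf (hT (hs i hi).le) (hTS (hs i hi))
    have finrank_submoduleOf : Module.finrank F ((S j).submoduleOf (T j)) =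
        Module.finrank F (T j ⊓ S j : Submodule F V) := by
      rw [← Submodule.finrank_map_subtype_eq, Submodule.submoduleOf, Submodule.map_comap_subtype]
    have finrank_add := Submodule.finrank_quotient_add_finrank ((S j).submoduleOf (T j))
    have le_finrank := Submodule.finrank_mono (hW j (Finset.mem_insert_self j s))
    rw [Finset.sum_insert fun h => lt_irrefl j (hs j h)]
    lia

end Filtration

section Ramification

variable {K : Type u} [Field K] {A : ValuationSubring K}

theorem absUpperGroup_le_absUpperGroupPlus {lam mu : ℝ} (h : lam < mu) :
    absUpperGroup A mu ≤ absUpperGroupPlus A lam :=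
  (le_iSup₂_of_le (f := fun mu _ => absUpperGroup A mu) mu h le_rfl).trans
    (Subgroup.le_topologicalClosure _)

theorem absUpperGroupPlus_antitone : Antitone (absUpperGroupPlus A) := fun _ _ h =>
  Subgroup.topologicalClosure_mono
    (iSup₂_le fun mu hmu => le_iSup₂_of_le mu (h.trans_lt hmu) le_rfl)

variable {F : Type} [Field F] {V : Type u} [AddCommGroup V] [Module F V]

theorem mem_fixedBy {G : Type u} [Group G] {ρ : Representation F G V} {H : Subgroup G} {v : V} :
    v ∈ fixedBy ρ H ↔ ∀ g ∈ H, ρ g v = v := by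
  simp [fixedBy, Representation.mem_invariants]

theorem fixedBy_antitone {G : Type u} [Group G] (ρ : Representation F G V) :
    Antitone (fixedBy ρ) := fun _ _ h _ hv =>
  mem_fixedBy.2 fun g hg => mem_fixedBy.1 hv g (h hg)

theorem fixedBy_eq_top {G : Type u} [Group G] {ρ : Representation F G V} {H : Subgroup G}
    (h : ∀ g ∈ H, ρ g = 1) : fixedBy ρ H = ⊤ :=
  eq_top_iff.2 fun v _ => mem_fixedBy.2 fun g hg => DFunLike.congr_fun (h g hg) v

theorem swan_le [FiniteDimensional F V] (ρ : Representation F Gal(SeparableClosure K/K) V)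
    {m : ℝ} (h : ∀ σ ∈ absUpperGroupPlus A m, ρ σ = 1) :
    swan A ρ ≤ ENNReal.ofReal m * Module.finrank F V := by
  let S (lam : {t : ℝ // 0 < t}) := fixedBy ρ (absUpperGroup A lam)
  let T (lam : {t : ℝ // 0 < t}) := fixedBy ρ (absUpperGroupPlus A lam)
  let d (lam) := Module.finrank F (T lam ⧸ (S lam).submoduleOf (T lam))
  have ofReal_mul_le (lam) : ENNReal.ofReal lam.1 * (d lam : ℝ≥0∞) ≤ .ofReal m * d lam := by
    rcases le_or_gt lam.1 m with hm | hm
    · gcongr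
    · have S_eq_top : S lam = ⊤ :=
        fixedBy_eq_top fun σ hσ => h σ (absUpperGroup_le_absUpperGroupPlus hm hσ)
      have : Subsingleton (T lam ⧸ (S lam).submoduleOf (T lam)) :=
        Submodule.Quotient.subsingleton_iff.2
          (Submodule.submoduleOf_eq_top.2 (S_eq_top ▸ le_top))
      simp [d, Module.finrank_zero_of_subsingleton]
  have sum_le (s : Finset _) : ∑ lam ∈ s, d lam ≤ Module.finrank F V := by
    simpa only [finrank_top] using sum_finrank_quotient_le_finrank (T := T) (S := S) (W := ⊤)
      (fun _ _ hle => fixedBy_antitone ρ (absUpperGroupPlus_antitone hle))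
      (fun _ _ hlt => fixedBy_antitone ρ (absUpperGroup_le_absUpperGroupPlus hlt)) s
      fun _ _ => le_top
  rw [swan, ENNReal.tsum_eq_iSup_sum]
  refine iSup_le fun s => ?_
  calc ∑ lam ∈ s, ENNReal.ofReal lam.1 * (d lam : ℝ≥0∞)
      ≤ ∑ lam ∈ s, ENNReal.ofReal m * (d lam : ℝ≥0∞) := Finset.sum_le_sum fun i _ => ofReal_mul_le i
    _ = ENNReal.ofReal m * (∑ lam ∈ s, d lam : ℕ) := by rw [Nat.cast_sum, Finset.mul_sum]
    _ ≤ ENNReal.ofReal m * Module.finrank F V := by gcongr; exact sum_le s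

end Ramification

section IdealOrder

variable {R : Type u} [CommRing R]

theorem idealOrder_bot [IsLocalRing R] : idealOrder (⊥ : Ideal R) = 0 := by
  simp [idealOrder]

variable [IsDomain R] [IsDiscreteValuationRing R]

theorem idealOrder_maximalIdeal_pow (n : ℕ) :
    idealOrder (IsLocalRing.maximalIdeal R ^ n) = n := by
  have : {j : ℕ | IsLocalRing.maximalIdeal R ^ n ≤ IsLocalRing.maximalIdeal R ^ j} = Set.Iic n :=
    Set.ext fun j => (Ideal.pow_right_strictAnti _ (IsDiscreteValuationRing.not_a_field R)
      (Ideal.IsPrime.ne_top inferInstance)).le_iff_ge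
  rw [idealOrder, this, csSup_Iic]

theorem idealOrder_pow (J : Ideal R) (r : ℕ) : idealOrder (J ^ r) = r * idealOrder J := by
  rcases eq_or_ne J ⊥ with rfl | hJ
  · rcases eq_or_ne r 0 with rfl | hr
    · simpa using idealOrder_maximalIdeal_pow (R := R) 0
    · rw [Ideal.bot_pow hr, idealOrder_bot, mul_zero]
  · obtain ⟨n, rfl⟩ := exists_maximalIdeal_pow_eq_of_principal R inferInstance J hJ
    rw [← pow_mul, idealOrder_maximalIdeal_pow, idealOrder_maximalIdeal_pow, mul_comm]

end IdealOrder

section StalkIdeal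

variable {X : Scheme.{u}} (I : X.IdealSheafData) {x : X}

theorem map_germ_ideal_eq_of_le {U V : X.affineOpens} (h : U ≤ V) (hx : x ∈ U.1) :
    (I.ideal U).map (X.presheaf.germ U.1 x hx).hom =
      (I.ideal V).map (X.presheaf.germ V.1 x (h hx)).hom := by
  rw [← I.map_ideal h, Ideal.map_map]
  congr 1
  exact RingHom.ext fun c => X.presheaf.germ_res_apply (homOfLE h) x hx c

theorem stalkIdeal_eq_map_germ {U : X.affineOpens} (hx : x ∈ U.1) :
    stalkIdeal I x = (I.ideal U).map (X.presheaf.germ U.1 x hx).hom := by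
  refine le_antisymm (iSup₂_le fun V hV => ?_) (le_iSup₂_of_le U hx le_rfl)
  obtain ⟨_, ⟨W, hW, rfl⟩, hxW, hWUV⟩ :=
    X.isBasis_affineOpens.exists_subset_of_mem_open (⟨hx, hV⟩ : x ∈ (U.1 ⊓ V.1 : X.Opens))
      (U.1 ⊓ V.1).isOpen
  have hWU : (⟨W, hW⟩ : X.affineOpens) ≤ U := fun _ h => (hWUV h).1
  have hWV : (⟨W, hW⟩ : X.affineOpens) ≤ V := fun _ h => (hWUV h).2
  rw [← map_germ_ideal_eq_of_le I hWV hxW, map_germ_ideal_eq_of_le I hWU hxW]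

theorem stalkIdeal_pow (x : X) (r : ℕ) : stalkIdeal (I ^ r) x = stalkIdeal I x ^ r := by
  obtain ⟨_, ⟨U, hU, rfl⟩, hx, -⟩ :=
    X.isBasis_affineOpens.exists_subset_of_mem_open (Set.mem_univ x) isOpen_univ
  rw [stalkIdeal_eq_map_germ (U := ⟨U, hU⟩) _ hx, stalkIdeal_eq_map_germ (U := ⟨U, hU⟩) _ hx,
    Scheme.IdealSheafData.ideal_pow, Pi.pow_apply, Ideal.map_pow]

theorem PointAtInfinity.mult_smul {k : Type u} [Field k] {s : X ⟶ Spec (.of k)} [IsVariety s]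
    {Xb : Compactification s} (P : PointAtInfinity Xb) (r : ℕ) (D : BoundaryDivisor Xb) :
    P.mult (D.smul r) = r * P.mult D := by
  simp only [mult, BoundaryDivisor.smul, stalkIdeal_pow, Ideal.map_pow, idealOrder_pow]

end StalkIdeal

section Coverings

/-- The class of finite étale morphisms of schemes: `isCovering X` consists of the `X`-schemes with
structure morphism in this class. -/
abbrev finiteEtale : MorphismProperty Scheme.{u} := @IsFinite ⊓ @Etale

instance : finiteEtale.{u}.IsMultiplicative := MorphismProperty.IsMultiplicative.inf

instance : finiteEtale.{u}.IsStableUnderBaseChange := MorphismProperty.IsStableUnderBaseChange.inf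

instance : finiteEtale.{u}.HasOfPostcompProperty finiteEtale where
  of_postcomp f g hg hfg := by
    obtain ⟨_, _⟩ := hg
    obtain ⟨_, _⟩ := hfg
    exact ⟨IsFinite.of_comp f g, Etale.of_comp f g⟩

variable {X : Scheme.{u}}

instance : (isCovering X).IsClosedUnderLimitsOfShape (Discrete PEmpty.{1}) :=
  Over.closedUnderLimitsOfShape_discrete_empty finiteEtale

instance : (isCovering X).IsClosedUnderLimitsOfShape WalkingCospan :=
  Over.closedUnderLimitsOfShape_pullback finiteEtale

instance : HasFiniteLimits (Cov X) :=
  hasFiniteLimits_of_hasTerminal_and_pullbacks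

instance : PreservesFiniteLimits (isCovering X).ι :=
  preservesFiniteLimits_of_preservesTerminal_and_pullbacks _

instance (Y : Cov X) : IsFinite Y.obj.hom := Y.property.1

instance (Y : Cov X) : Etale Y.obj.hom := Y.property.2

variable {Y Z : Cov X}

theorem finiteEtale_left (f : Y ⟶ Z) : finiteEtale f.hom.left :=
  MorphismProperty.of_postcomp finiteEtale (W' := finiteEtale) f.hom.left Z.obj.hom Z.property
    ((Over.w f.hom).symm ▸ Y.property)

theorem isClopen_range_left (f : Y ⟶ Z) : IsClopen (Set.range f.hom.left) := by
  obtain ⟨_, _⟩ := finiteEtale_left f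
  exact ⟨f.hom.left.isClosedMap.isClosed_range, f.hom.left.isOpenMap.isOpen_range⟩

instance isOpenImmersion_left_of_mono (f : Y ⟶ Z) [Mono f] : IsOpenImmersion f.hom.left := by
  obtain ⟨_, _⟩ := finiteEtale_left f
  have : Mono f.hom := inferInstanceAs (Mono ((isCovering X).ι.map f))
  exact IsOpenImmersion.of_flat_of_mono f.hom.left

/-- The covering defined by an open and closed subscheme of a covering. -/
def clopenCovering (Y : Cov X) (U : Y.obj.left.Opens) (hU : IsClosed (U : Set Y.obj.left)) :
    Cov X :=
  ⟨Over.mk (U.ι ≫ Y.obj.hom), by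
    have : IsClosedImmersion U.ι := .of_isPreimmersion _ (by rwa [Scheme.Opens.range_ι])
    exact ⟨inferInstanceAs (IsFinite (_ ≫ _)), inferInstanceAs (Etale (_ ≫ _))⟩⟩

/-- The inclusion of an open and closed subscheme, as a morphism of coverings. -/
def clopenCoveringι (Y : Cov X) (U : Y.obj.left.Opens) (hU : IsClosed (U : Set Y.obj.left)) :
    clopenCovering Y U hU ⟶ Y :=
  ObjectProperty.homMk (Over.homMk U.ι)

end Coverings

section Fibres

variable {X : Scheme.{u}} {Ω Ω' : Type u} [Field Ω] [Field Ω']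
  {x : Spec (.of Ω) ⟶ X} {x' : Spec (.of Ω') ⟶ X}

/-- The point of the scheme `Y` underlying a geometric point of the `X`-scheme `Y`. -/
def imagePoint {Y : Over X} (y : Over.mk x ⟶ Y) : Y.left :=
  y.left (default : Spec (.of Ω))

theorem imagePoint_comp_mem_range {Y Z : Over X} (y : Over.mk x ⟶ Y) (f : Y ⟶ Z) :
    imagePoint (y ≫ f) ∈ Set.range f.left :=
  ⟨imagePoint y, rfl⟩

theorem exists_comp_eq_iff_imagePoint_mem_range {Y Z : Over X} (f : Y ⟶ Z)
    [IsOpenImmersion f.left] (z : Over.mk x ⟶ Z) :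
    (∃ y, y ≫ f = z) ↔ imagePoint z ∈ Set.range f.left := by
  refine ⟨fun ⟨y, hy⟩ => hy ▸ imagePoint_comp_mem_range y f, fun hz => ?_⟩
  have range_subset : Set.range z.left ⊆ Set.range f.left := by
    rintro _ ⟨t, rfl⟩
    rwa [Subsingleton.elim (α := Spec (.of Ω)) t default]
  have lift_comp := IsOpenImmersion.lift_fac f.left z.left range_subset
  refine ⟨Over.homMk (IsOpenImmersion.lift f.left z.left range_subset) ?_, ?_⟩
  · rw [← Over.w f, reassoc_of% lift_comp]
    exact Over.w z
  · ext1
    exact lift_comp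

/-- The map of fibres over the covering `Y` given by a natural transformation of fibre functors. -/
def fibreMap (α : fibre (isCovering X) x ⟶ fibre (isCovering X) x') (Y : Cov X)
    (y : Over.mk x ⟶ Y.obj) : Over.mk x' ⟶ Y.obj :=
  α.app Y y

variable (α : fibre (isCovering X) x ⟶ fibre (isCovering X) x') {Y Z : Cov X}

theorem fibreMap_comp (f : Y ⟶ Z) (y : Over.mk x ⟶ Y.obj) :
    fibreMap α Z (y ≫ f.hom) = fibreMap α Y y ≫ f.hom :=
  ConcreteCategory.congr_hom (α.naturality f) y

theorem imagePoint_fibreMap_mem {U : Set Y.obj.left} (hU : IsClopen U)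
    {y : Over.mk x ⟶ Y.obj} (hy : imagePoint y ∈ U) : imagePoint (fibreMap α Y y) ∈ U := by
  let ι := clopenCoveringι Y ⟨U, hU.isOpen⟩ hU.isClosed
  have range_ι : Set.range ι.hom.left = U := Scheme.Opens.range_ι _
  have : IsOpenImmersion ι.hom.left := inferInstanceAs (IsOpenImmersion (Scheme.Opens.ι _))
  obtain ⟨z, rfl⟩ := (exists_comp_eq_iff_imagePoint_mem_range ι.hom y).2 (range_ι.symm ▸ hy)
  rw [fibreMap_comp]
  exact range_ι.subset (imagePoint_comp_mem_range _ _)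

theorem imagePoint_fibreMap_mem_iff {U : Set Y.obj.left} (hU : IsClopen U)
    (y : Over.mk x ⟶ Y.obj) : imagePoint (fibreMap α Y y) ∈ U ↔ imagePoint y ∈ U :=
  ⟨fun h => by_contra fun hy => imagePoint_fibreMap_mem α hU.compl hy h,
    imagePoint_fibreMap_mem α hU⟩

theorem exists_comp_eq_fibreMap_iff_of_mono (f : Y ⟶ Z) [Mono f] (z : Over.mk x ⟶ Z.obj) :
    (∃ y, y ≫ f.hom = fibreMap α Z z) ↔ ∃ y, y ≫ f.hom = z := by
  rw [exists_comp_eq_iff_imagePoint_mem_range, exists_comp_eq_iff_imagePoint_mem_range,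
    imagePoint_fibreMap_mem_iff α (isClopen_range_left f)]

theorem exists_comp_equalizer_ι_eq_iff (f g : Y ⟶ Z) (y : Over.mk x ⟶ Y.obj) :
    (∃ w, w ≫ (equalizer.ι f g).hom = y) ↔ y ≫ f.hom = y ≫ g.hom := by
  constructor
  · rintro ⟨w, rfl⟩
    rw [Category.assoc, Category.assoc]
    exact congrArg (w ≫ ·.hom) (equalizer.condition f g)
  · intro h
    let lift := Fork.IsLimit.lift'
      (isLimitForkMapOfIsLimit (isCovering X).ι _ (equalizerIsEqualizer f g)) y h
    exact ⟨lift.1, lift.2⟩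

instance : PreservesFiniteLimits (fibre (isCovering X) x) :=
  inferInstanceAs (PreservesFiniteLimits ((isCovering X).ι ⋙ coyoneda.obj _))

instance : IsCofiltered (fibre (isCovering X) x).Elements :=
  Functor.isCofiltered_elements _

theorem exists_common_lift (y : Over.mk x ⟶ Y.obj) (z : Over.mk x ⟶ Z.obj) :
    ∃ (W : Cov X) (w : Over.mk x ⟶ W.obj) (p : W ⟶ Y) (q : W ⟶ Z),
      w ≫ p.hom = y ∧ w ≫ q.hom = z := by
  obtain ⟨W, p, q, -⟩ :=
    IsCofilteredOrEmpty.cone_objs (C := (fibre (isCovering X) x).Elements) ⟨Y, y⟩ ⟨Z, z⟩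
  exact ⟨W.1, W.2, p.1, q.1, p.2, q.2⟩

theorem fibreMap_injective (Y : Cov X) : Function.Injective (fibreMap α Y) := by
  intro y z hyz
  obtain ⟨W, w, p, q, rfl, rfl⟩ := exists_common_lift y z
  rw [← exists_comp_equalizer_ι_eq_iff, ← exists_comp_eq_fibreMap_iff_of_mono α,
    exists_comp_equalizer_ι_eq_iff, ← fibreMap_comp, ← fibreMap_comp]
  exact hyz

end Fibres

section Paths

theorem finite_retractions_of_finite {Ω : Type u} [Field Ω] {R : CommRingCat.{u}}
    (φ : .of Ω ⟶ R) (hφ : φ.hom.Finite) : Finite {ψ : R ⟶ .of Ω // φ ≫ ψ = 𝟙 _} := by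
  algebraize [φ.hom]
  let toAlgHom (ψ : {ψ : R ⟶ .of Ω // φ ≫ ψ = 𝟙 _}) : R →ₐ[Ω] Ω :=
    { ψ.1.hom with commutes' := fun c => ConcreteCategory.congr_hom ψ.2 c }
  exact Finite.of_injective toAlgHom fun _ _ h =>
    Subtype.ext (CommRingCat.hom_ext (congrArg AlgHom.toRingHom h))

theorem finite_sections_of_isFinite {Ω : Type u} [Field Ω] {Z : Scheme.{u}}
    (f : Z ⟶ Spec (.of Ω)) [IsFinite f] : Finite {g : Spec (.of Ω) ⟶ Z // g ≫ f = 𝟙 _} := by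
  have : IsAffine Z := isAffine_of_isAffineHom f
  obtain ⟨φ, hφ⟩ := Spec.map_surjective (Z.isoSpec.inv ≫ f)
  have : Finite {ψ // φ ≫ ψ = 𝟙 _} :=
    finite_retractions_of_finite φ (by rw [← IsFinite.SpecMap_iff, hφ]; infer_instance)
  refine Finite.of_injective (β := {ψ // φ ≫ ψ = 𝟙 _})
    (fun g => ⟨Spec.preimage (g.1 ≫ Z.isoSpec.hom), Spec.map_injective ?_⟩) fun g h hgh => ?_
  · simp [hφ, g.2]
  · exact Subtype.ext ((cancel_mono Z.isoSpec.hom).1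
      (Spec.homEquiv.injective (congrArg Subtype.val hgh)))

variable {X : Scheme.{u}} {Ω Ω' : Type u} [Field Ω] [Field Ω']

theorem finite_fibre_of_isFinite (x : Spec (.of Ω) ⟶ X) (Y : Over X) [IsFinite Y.hom] :
    Finite (Over.mk x ⟶ Y) := by
  have := finite_sections_of_isFinite (pullback.fst x Y.hom)
  let toSection (y : Over.mk x ⟶ Y) : {g // g ≫ pullback.fst x Y.hom = 𝟙 _} :=
    ⟨pullback.lift (𝟙 _) y.left ((Category.id_comp x).trans (Over.w y).symm),
      pullback.lift_fst _ _ _⟩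
  have toSection_snd (y) : (toSection y).1 ≫ pullback.snd x Y.hom = y.left :=
    pullback.lift_snd _ _ _
  refine Finite.of_injective toSection fun y z h => Over.OverMorphism.ext ?_
  rw [← toSection_snd y, h, toSection_snd]

theorem nonempty_fibre [ConnectedSpace X] [IsSepClosed Ω] (x : Spec (.of Ω) ⟶ X) (Y : Cov X)
    [Nonempty Y.obj.left] : Nonempty (Over.mk x ⟶ Y.obj) := by
  have range_eq_univ : Set.range Y.obj.hom = Set.univ :=
    IsClopen.eq_univ ⟨Y.obj.hom.isClosedMap.isClosed_range, Y.obj.hom.isOpenMap.isOpen_range⟩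
      (Set.range_nonempty _)
  obtain ⟨y, hy⟩ : x default ∈ Set.range Y.obj.hom := range_eq_univ ▸ Set.mem_univ _
  obtain ⟨l, hl, -⟩ := Scheme.exists_fac_of_etale_of_isSepClosed Y.obj.hom x y hy
  exact ⟨Over.homMk l hl⟩

variable [ConnectedSpace X] [IsSepClosed Ω'] (x : Spec (.of Ω) ⟶ X) (x' : Spec (.of Ω') ⟶ X)

theorem nonempty_fibre_hom : Nonempty (fibre (isCovering X) x ⟶ fibre (isCovering X) x') := by
  let G := CategoryOfElements.π (fibre (isCovering X) x) ⋙ fibre (isCovering X) x'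
  have finite_obj (j) : Finite (G.obj j) := finite_fibre_of_isFinite x' j.1.obj
  have nonempty_obj (j) : Nonempty (G.obj j) :=
    have : Nonempty j.1.obj.left := ⟨imagePoint (x := x) j.2⟩
    nonempty_fibre x' j.1
  obtain ⟨t, ht⟩ := nonempty_sections_of_finite_cofiltered_system G
  exact ⟨{
    app := fun Y => TypeCat.ofHom fun y => t ⟨Y, y⟩
    naturality := fun Y Z f => by
      ext y
      exact (ht (j := ⟨Y, y⟩) (j' := ⟨Z, (fibre (isCovering X) x).map f y⟩) ⟨f, rfl⟩).symm }⟩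

theorem nonempty_fibre_iso [IsSepClosed Ω] :
    Nonempty (fibre (isCovering X) x ≅ fibre (isCovering X) x') := by
  obtain ⟨α⟩ := nonempty_fibre_hom x x'
  obtain ⟨β⟩ := nonempty_fibre_hom x' x
  have (Y : Cov X) : IsIso (α.app Y) := by
    have : Finite (Over.mk x ⟶ Y.obj) := finite_fibre_of_isFinite x Y.obj
    have : Finite (Over.mk x' ⟶ Y.obj) := finite_fibre_of_isFinite x' Y.obj
    exact (isIso_iff_bijective _).2 ((fibreMap_injective α Y).bijective_of_nat_card_le
      (Nat.card_le_card_of_injective _ (fibreMap_injective β Y)))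
  have : IsIso α := NatIso.isIso_of_isIso_app α
  exact ⟨asIso α⟩

theorem restrictHom_conjAut {X : Scheme.{u}} {Ω Ω' : Type u} [Field Ω] [Field Ω']
    {P Q : ObjectProperty (Over X)} (h : P ≤ Q) {x : Spec (.of Ω) ⟶ X} {x' : Spec (.of Ω') ⟶ X}
    (e : fibre Q x ≅ fibre Q x') (σ : fundamentalGroup Q x) :
    restrictHom h x' (e.conjAut σ) =
      (Functor.isoWhiskerLeft (ObjectProperty.ιOfLE h) e).conjAut (restrictHom h x σ) :=
  rfl

end Paths

namespace SmoothSheaf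

variable {ℓ : ℕ} [Fact ℓ.Prime] {X : Scheme.{u}} (F : SmoothSheaf ℓ X)
  {Ω Ω' Ω'' : Type u} [Field Ω] [Field Ω'] [Field Ω'']
  {x : Spec (.of Ω) ⟶ X} {x' : Spec (.of Ω') ⟶ X} {x'' : Spec (.of Ω'') ⟶ X}

section Transport

/-- The map `F_{n,x} → F_{n,x'}` induced by a natural transformation of fibre functors, through the
identification of `F_n` with the functor of points of a covering. -/
def transport (α : fibre (isCovering X) x ⟶ fibre (isCovering X) x') (n : ℕ)
    (a : F.sec n (Over.mk x)) : F.sec n (Over.mk x') :=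
  (F.repr n).homEquiv (fibreMap α (F.covObj n) ((F.repr n).homEquiv.symm a))

variable (α : fibre (isCovering X) x ⟶ fibre (isCovering X) x') {n : ℕ}

theorem transport_map {Y : Cov X} (b : F.sec n Y.obj) (y : Over.mk x ⟶ Y.obj) :
    F.transport α n ((F.sheaf n).map y.op b) = (F.sheaf n).map (fibreMap α Y y).op b := by
  obtain ⟨f, rfl⟩ := (F.repr n).homEquiv.surjective b
  rw [← homEquiv_comp, ← homEquiv_comp, transport, Equiv.symm_apply_apply]
  exact congrArg _ (fibreMap_comp α (Z := F.covObj n) (ObjectProperty.homMk f) y)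

theorem exists_map_eq (a : F.sec n (Over.mk x)) :
    ∃ (Y : Cov X) (y : Over.mk x ⟶ Y.obj) (b : F.sec n Y.obj), (F.sheaf n).map y.op b = a :=
  have ⟨y, hy⟩ := F.exists_map x n a
  ⟨F.covObj n, y, _, hy⟩

theorem exists_map_eq_and_map_eq (a a' : F.sec n (Over.mk x)) :
    ∃ (Y : Cov X) (y : Over.mk x ⟶ Y.obj) (b b' : F.sec n Y.obj),
      (F.sheaf n).map y.op b = a ∧ (F.sheaf n).map y.op b' = a' := by
  obtain ⟨Y, y, b, rfl⟩ := F.exists_map_eq a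
  obtain ⟨Y', y', b', rfl⟩ := F.exists_map_eq a'
  obtain ⟨W, w, p, q, rfl, rfl⟩ := exists_common_lift y y'
  exact ⟨W, w, (F.sheaf n).map p.hom.op b, (F.sheaf n).map q.hom.op b', by simp, by simp⟩

theorem transport_add (a a' : F.sec n (Over.mk x)) :
    F.transport α n (a + a') = F.transport α n a + F.transport α n a' := by
  obtain ⟨Y, y, b, b', rfl, rfl⟩ := F.exists_map_eq_and_map_eq a a'
  rw [← map_add, transport_map, transport_map, transport_map, map_add]

theorem transport_smul (c : IntRing F.E) (a : F.sec n (Over.mk x)) :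
    F.transport α n (c • a) = c • F.transport α n a := by
  obtain ⟨Y, y, b, rfl⟩ := F.exists_map_eq a
  rw [← map_smul, transport_map, transport_map, map_smul]

theorem trans_transport (a : F.sec (n + 1) (Over.mk x)) :
    (F.trans n).app (op (Over.mk x')) (F.transport α (n + 1) a) =
      F.transport α n ((F.trans n).app (op (Over.mk x)) a) := by
  obtain ⟨Y, y, b, rfl⟩ := F.exists_map_eq a
  rw [transport_map, NatTrans.naturality_apply, NatTrans.naturality_apply, transport_map]

/-- The linear map `lim_n F_{n,x} → lim_n F_{n,x'}` induced by a natural transformation of fibre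
functors. -/
def latticeMap : F.lattice (Over.mk x) →ₗ[IntRing F.E] F.lattice (Over.mk x') where
  toFun a := ⟨fun n => F.transport α n (a.1 n), fun n => by rw [trans_transport, a.2 n]⟩
  map_add' a b := Subtype.ext (funext fun n => F.transport_add α (a.1 n) (b.1 n))
  map_smul' c a := Subtype.ext (funext fun n => F.transport_smul α c (a.1 n))

/-- The linear map of stalks `F_x → F_{x'}` induced by a natural transformation of fibre
functors. -/
def stalkMap : F.stalk (Over.mk x) →ₗ[PadicAlgCl ℓ] F.stalk (Over.mk x') :=
  (F.latticeMap α).baseChange (PadicAlgCl ℓ)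

theorem stalkMap_id : F.stalkMap (𝟙 (fibre (isCovering X) x)) = LinearMap.id := by
  have : F.latticeMap (𝟙 (fibre (isCovering X) x)) = LinearMap.id :=
    LinearMap.ext fun a => Subtype.ext (funext fun n => (F.repr n).homEquiv.apply_symm_apply _)
  rw [stalkMap, this, LinearMap.baseChange_id]

theorem stalkMap_comp (β : fibre (isCovering X) x' ⟶ fibre (isCovering X) x'') :
    F.stalkMap (α ≫ β) = F.stalkMap β ∘ₗ F.stalkMap α := by
  have : F.latticeMap (α ≫ β) = F.latticeMap β ∘ₗ F.latticeMap α :=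
    LinearMap.ext fun a => Subtype.ext (funext fun n => congrArg (F.repr n).homEquiv
      (congrArg (fibreMap β (F.covObj n)) ((F.repr n).homEquiv.symm_apply_apply _).symm))
  rw [stalkMap, this, LinearMap.baseChange_comp]
  rfl

end Transport

section Path

variable {F} (e : fibre (isCovering X) x ≅ fibre (isCovering X) x')

variable (F) in
/-- The isomorphism of stalks `F_x ≃ F_{x'}` given by a path from `x` to `x'`. -/
def stalkEquiv : F.stalk (Over.mk x) ≃ₗ[PadicAlgCl ℓ] F.stalk (Over.mk x') :=
  LinearEquiv.ofLinearMap (F.stalkMap e.hom) (F.stalkMap e.inv)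
    (by rw [← stalkMap_comp, e.inv_hom_id, stalkMap_id])
    (by rw [← stalkMap_comp, e.hom_inv_id, stalkMap_id])

theorem HasRank.of_iso {r : ℕ} (hr : F.HasRank x r)
    (e : fibre (isCovering X) x ≅ fibre (isCovering X) x') : F.HasRank x' r :=
  (F.stalkEquiv e).rank_eq.symm.trans hr

theorem HasRank.finiteDimensional {r : ℕ} (hr : F.HasRank x r) :
    FiniteDimensional (PadicAlgCl ℓ) (F.stalk (Over.mk x)) :=
  Module.rank_lt_aleph0_iff.1 (hr.trans_lt Cardinal.natCast_lt_aleph0)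

theorem HasRank.finrank_eq {r : ℕ} (hr : F.HasRank x r) :
    Module.finrank (PadicAlgCl ℓ) (F.stalk (Over.mk x)) = r :=
  Module.finrank_eq_of_rank_eq hr

variable (F) in
theorem monodromy_eq_stalkMap (σ : fundamentalGroup (isCovering X) x) :
    F.monodromy x σ = F.stalkMap σ.hom :=
  rfl

variable (F) in
theorem monodromy_conjAut (σ : fundamentalGroup (isCovering X) x) :
    F.monodromy x' (e.conjAut σ) = F.stalkMap e.hom ∘ₗ F.monodromy x σ ∘ₗ F.stalkMap e.inv := by
  simp only [monodromy_eq_stalkMap, ← stalkMap_comp]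
  congr 1

end Path

end SmoothSheaf

section Galois

variable {X : Scheme.{u}} {K : Type u} [Field K]

/-- The geometric point `Spec K^sep → Spec K → X` as a morphism of schemes; `SmoothSheaf.sepPoint a`
is the corresponding object of `Over X`. -/
abbrev sepPointHom (a : Spec (.of K) ⟶ X) : Spec (.of (SeparableClosure K)) ⟶ X :=
  Spec.map (CommRingCat.ofHom (algebraMap K (SeparableClosure K))) ≫ a

variable (P : ObjectProperty (Over X)) (a : Spec (.of K) ⟶ X)

/-- The action of `G_K` on the fibre functor at the geometric point `Spec K^sep → Spec K → X`. -/
def galoisEnd : Gal(SeparableClosure K/K) →* End (fibre P (sepPointHom a)) where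
  toFun σ := Functor.whiskerLeft P.ι (coyoneda.map (SmoothSheaf.sepHom a σ).op)
  map_one' := by
    refine NatTrans.ext (funext fun Y => ?_)
    ext y
    change SmoothSheaf.sepHom a 1 ≫ y = y
    rw [SmoothSheaf.sepHom_one]
    exact Category.id_comp y
  map_mul' σ τ := by
    refine NatTrans.ext (funext fun Y => ?_)
    ext y
    change SmoothSheaf.sepHom a (σ * τ) ≫ y =
      SmoothSheaf.sepHom a σ ≫ SmoothSheaf.sepHom a τ ≫ y
    rw [SmoothSheaf.sepHom_mul]
    exact Category.assoc _ _ _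

/-- The homomorphism `G_K → π₁(X, x)` induced by `Spec K → X`, where `x` is the geometric point
`Spec K^sep → Spec K → X`. -/
def galoisHom : Gal(SeparableClosure K/K) →* fundamentalGroup P (sepPointHom a) :=
  (Aut.unitsEndEquivAut _).toMonoidHom.comp (galoisEnd P a).toHomUnits

theorem galoisHom_eq_one {σ : Gal(SeparableClosure K/K)}
    (h : ∀ (Y : P.FullSubcategory) (y : SmoothSheaf.sepPoint a ⟶ Y.obj),
      SmoothSheaf.sepHom a σ ≫ y = y) :
    galoisHom P a σ = 1 := by
  apply Iso.ext
  ext Y y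
  exact h Y y

theorem restrictHom_galoisHom {P Q : ObjectProperty (Over X)} (h : P ≤ Q)
    (σ : Gal(SeparableClosure K/K)) :
    restrictHom h (sepPointHom a) (galoisHom Q a σ) = galoisHom P a σ :=
  rfl

theorem SmoothSheaf.galoisRep_eq_monodromy_comp {ℓ : ℕ} [Fact ℓ.Prime] (F : SmoothSheaf ℓ X) :
    F.galoisRep a = (F.monodromy (sepPointHom a)).comp (galoisHom (isCovering X) a) := by
  ext1 σ
  have : F.latticeEnd (sepPoint a) (fun n => ((F.sheaf n).map (sepHom a σ).op).hom)
      (fun n b => (ConcreteCategory.congr_hom ((F.trans n).naturality (sepHom a σ).op) b)) =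
      F.latticeMap (galoisHom (isCovering X) a σ).hom :=
    LinearMap.ext fun b => Subtype.ext (funext fun n => by
      change (F.sheaf n).map (sepHom a σ).op (b.1 n) =
        (F.repr n).homEquiv (sepHom a σ ≫ (F.repr n).homEquiv.symm (b.1 n))
      rw [homEquiv_comp, Equiv.apply_symm_apply])
  exact congrArg (LinearMap.baseChange _) this

end Galois

section Bounded

theorem map_comp_eq_of_ramificationBounded {K : Type u} [Field K] {A : ValuationSubring K} {m : ℝ}
    {Z : Scheme.{u}} {f : Z ⟶ Spec (.of K)}
    (hf : ∀ z, RamificationBounded A (Spec.preimage (Z.fromSpecResidueField z ≫ f)).hom m)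
    {g : Spec (.of (SeparableClosure K)) ⟶ Z}
    (hg : g ≫ f = Spec.map (CommRingCat.ofHom (algebraMap K (SeparableClosure K))))
    {σ : Gal(SeparableClosure K/K)} (hσ : σ ∈ absUpperGroupPlus A m) :
    Spec.map (CommRingCat.ofHom (σ : SeparableClosure K →+* SeparableClosure K)) ≫ g = g := by
  let z := g (IsLocalRing.closedPoint (SeparableClosure K))
  let φ : Z.residueField z ⟶ .of (SeparableClosure K) :=
    Scheme.descResidueField (Scheme.stalkClosedPointTo g)
  have hφ : Spec.map φ ≫ Z.fromSpecResidueField z = g :=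
    Scheme.descResidueField_stalkClosedPointTo_fromSpecResidueField _ _ g
  have preimage_comp : Spec.preimage (Z.fromSpecResidueField z ≫ f) ≫ φ =
      CommRingCat.ofHom (algebraMap K (SeparableClosure K)) :=
    Spec.map_injective (by rw [Spec.map_comp, Spec.map_preimage, reassoc_of% hφ, hg])
  have comp_σ : φ ≫ CommRingCat.ofHom (σ : SeparableClosure K →+* SeparableClosure K) = φ :=
    CommRingCat.hom_ext (RingHom.ext
      (hf z φ.hom (congrArg CommRingCat.Hom.hom preimage_comp) σ hσ))
  rw [← hφ, ← Spec.map_comp_assoc, comp_σ]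

variable {k : Type u} [Field k] {X : Scheme.{u}} {s : X ⟶ Spec (.of k)} [IsVariety s]
  {Xb : Compactification s} {D : BoundaryDivisor Xb}

theorem HasBoundedRamification.sepHom_comp {Y : Over X} (hY : HasBoundedRamification D Y)
    (P : PointAtInfinity Xb) {σ : Gal(SeparableClosure P.K/P.K)}
    (hσ : σ ∈ absUpperGroupPlus P.O (P.mult D)) (y : SmoothSheaf.sepPoint P.toX ⟶ Y) :
    SmoothSheaf.sepHom P.toX σ ≫ y = y := by
  let l : Spec (.of (SeparableClosure P.K)) ⟶ pullback Y.hom P.toX :=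
    pullback.lift y.left _ (Over.w y)
  have l_fst : l ≫ pullback.fst _ _ = y.left := pullback.lift_fst _ _ _
  have l_snd : l ≫ pullback.snd _ _ = _ := pullback.lift_snd _ _ _
  have comp_l := map_comp_eq_of_ramificationBounded (hY P) l_snd hσ
  ext1
  change Spec.map _ ≫ y.left = y.left
  rw [← l_fst, reassoc_of% comp_l]

theorem galoisHom_isBoundedCovering_eq_one (P : PointAtInfinity Xb)
    {σ : Gal(SeparableClosure P.K/P.K)} (hσ : σ ∈ absUpperGroupPlus P.O (P.mult D)) :
    galoisHom (isBoundedCovering D) P.toX σ = 1 :=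
  galoisHom_eq_one _ _ fun Y => Y.property.2.sepHom_comp P hσ

namespace SmoothSheaf

variable {ℓ : ℕ} [Fact ℓ.Prime] {F : SmoothSheaf ℓ X} {Ω Ω' : Type u} [Field Ω] [Field Ω']
  {x : Spec (.of Ω) ⟶ X} {x' : Spec (.of Ω') ⟶ X}

theorem FactorsThrough.monodromy_eq_one (hF : F.FactorsThrough x D)
    (e : fibre (isCovering X) x ≅ fibre (isCovering X) x')
    {σ : fundamentalGroup (isCovering X) x'} (hσ : restrictHom (isBoundedCovering_le D) x' σ = 1) :
    F.monodromy x' σ = 1 := by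
  obtain ⟨ρ, hρ⟩ := hF
  have restrict_eq_one : restrictHom (isBoundedCovering_le D) x (e.symm.conjAut σ) = 1 := by
    rw [restrictHom_conjAut, hσ]
    exact map_one _
  have monodromy_eq_one : F.monodromy x (e.symm.conjAut σ) = LinearMap.id := by
    rw [hρ, MonoidHom.comp_apply, restrict_eq_one, map_one]
    rfl
  have conj_conj : e.conjAut (e.symm.conjAut σ) = σ := e.conjAut.apply_symm_apply σ
  rw [← conj_conj, monodromy_conjAut, monodromy_eq_one, LinearMap.id_comp, ← stalkMap_comp,
    e.inv_hom_id, stalkMap_id]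
  rfl

theorem FactorsThrough.galoisRep_eq_one (hF : F.FactorsThrough x D) (P : PointAtInfinity Xb)
    (e : fibre (isCovering X) x ≅ fibre (isCovering X) (sepPointHom P.toX))
    {σ : Gal(SeparableClosure P.K/P.K)} (hσ : σ ∈ absUpperGroupPlus P.O (P.mult D)) :
    F.galoisRep P.toX σ = 1 := by
  rw [galoisRep_eq_monodromy_comp]
  refine hF.monodromy_eq_one e ?_
  rw [restrictHom_galoisHom, galoisHom_isBoundedCovering_eq_one P hσ]

end SmoothSheaf

end Bounded

end SwanBound

end

open CategoryTheory AlgebraicGeometry SwanBound in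
theorem mainTheorem7_general {k : Type u} [Field k] (ℓ : ℕ) [Fact ℓ.Prime]
    {X : Scheme.{u}} (s : X ⟶ Spec (.of k)) [IsVariety s] (Xb : Compactification s)
    {Ω : Type u} [Field Ω] [IsSepClosed Ω] (x : Spec (.of Ω) ⟶ X)
    (F : SmoothSheaf ℓ X) (r : ℕ) (hr : F.HasRank x r)
    (D : BoundaryDivisor Xb) (hF : F.FactorsThrough x D) :
    F.SwanLE (D.smul r) := by
  have : ConnectedSpace X := IsVariety.connected s
  intro P
  obtain ⟨e⟩ := nonempty_fibre_iso x (sepPointHom P.toX)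
  have hr' : F.HasRank (sepPointHom P.toX) r := hr.of_iso e
  have : FiniteDimensional (PadicAlgCl ℓ) (F.stalk (SmoothSheaf.sepPoint P.toX)) :=
    hr'.finiteDimensional
  have finrank_eq : Module.finrank (PadicAlgCl ℓ) (F.stalk (SmoothSheaf.sepPoint P.toX)) = r :=
    hr'.finrank_eq
  calc F.swanAt P
      ≤ ENNReal.ofReal (P.mult D) *
          (Module.finrank (PadicAlgCl ℓ) (F.stalk (SmoothSheaf.sepPoint P.toX))) :=
        swan_le _ fun σ hσ => hF.galoisRep_eq_one P e hσ
    _ = (P.mult (D.smul r)) := by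
        rw [finrank_eq, P.mult_smul, ENNReal.ofReal_natCast, Nat.cast_mul, mul_comm]

open CategoryTheory AlgebraicGeometry SwanBound in
theorem mainTheorem7 {k : Type u} [Field k] [Finite k] (ℓ : ℕ) [Fact ℓ.Prime] (hℓ : (ℓ : k) ≠ 0)
    {X : Scheme.{u}} (s : X ⟶ Spec (.of k)) [IsVariety s] (Xb : Compactification s)
    {Ω : Type u} [Field Ω] [IsSepClosed Ω] (x : Spec (.of Ω) ⟶ X)
    (F : SmoothSheaf ℓ X) (r : ℕ) (hr : F.HasRank x r)
    (D : BoundaryDivisor Xb) (hF : F.FactorsThrough x D) :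
    F.SwanLE (D.smul r) :=
  mainTheorem7_general ℓ s Xb x F r hr D hF
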